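/- Let $S=k[x_1,\ldots,x_n]$ be a polynomial ring over a field $k$, let $M$ be a monomial ideal of $S$ with minimal generating set of monomials $G$, and let $l$ be a monomial of $S$. A set $D$ of monomials is called dominant if for every $m\in D$ there is a variable $x$ such that the exponent of $x$ in $m$ is larger than the exponent of $x$ in every other element of $D$. A monomial $x_1^{\alpha_1}\cdots x_n^{\alpha_n}$ strongly divides $x_1^{\beta_1}\cdots x_n^{\beta_n}$ if $\alpha_i<\beta_i$ whenever $\alpha_i\neq 0$. Let $\mathscr{D}_M$ be the class of all dominant subsets $D\subseteq G$ of cardinality $n$ such that no element of $G$ strongly divides $\mathrm{lcm}(D)$. Let $\beta_{n,l}(S/M)$ be the multigraded Betti number of $S/M$ in homological degree $n$ and multidegree $l$, that is, the number of basis elements of multidegree $l$ of the $n$-th free module in a minimal multigraded free resolution of $S/M$. (Such a resolution exists, and the number does not depend on its choice.) Then \[\beta_{n,l}(S/M)=\begin{cases}1, & \text{if there is } D\in\mathscr{D}_M \text{ with } l=\mathrm{lcm}(D),\\ 0, & \text{otherwise.}\end{cases}\] -/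

import Mathlib

open MvPolynomial

universe u v

/-! A monomial `x₁ ^ a₁ ⋯ xₙ ^ aₙ` is represented by its exponent vector `a : Fin n →₀ ℕ`: products
of monomials are sums of exponent vectors, divisibility is `≤`, and the least common multiple is the
supremum. -/

namespace MonomialResolution

noncomputable section

/-- The ideal of `k[x₁, …, xₙ]` generated by a set of monomials. -/
def monomialSpan {n : ℕ} (k : Type*) [Field k] (A : Set (Fin n →₀ ℕ)) :
    Ideal (MvPolynomial (Fin n) k) :=
  Ideal.span ((fun a => monomial a (1 : k)) '' A)

/-- A monomial ideal is an ideal generated by monomials. -/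
def IsMonomialIdeal {n : ℕ} {k : Type*} [Field k] (M : Ideal (MvPolynomial (Fin n) k)) : Prop :=
  ∃ A : Set (Fin n →₀ ℕ), M = monomialSpan k A

/-- The minimal generators of a monomial ideal `M`: the monomials of `M` that are not divisible by
another monomial of `M`. By `isLeast_minimalGenerators` this is the minimal generating set
of `M`. -/
def minimalGenerators {n : ℕ} {k : Type*} [Field k] (M : Ideal (MvPolynomial (Fin n) k)) :
    Set (Fin n →₀ ℕ) :=
  {a | Minimal (fun b => monomial b (1 : k) ∈ M) a}

theorem mem_monomialSpan_iff {n : ℕ} {k : Type*} [Field k] {A : Set (Fin n →₀ ℕ)}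
    {b : Fin n →₀ ℕ} : monomial b (1 : k) ∈ monomialSpan k A ↔ ∃ a ∈ A, a ≤ b := by
  classical
  simp [monomialSpan, mem_ideal_span_monomial_image, support_monomial]

/-- Among the sets of monomials that generate the monomial ideal `M`, the set of minimal generators
is the smallest one. -/
theorem isLeast_minimalGenerators {n : ℕ} {k : Type*} [Field k]
    {M : Ideal (MvPolynomial (Fin n) k)} (hM : IsMonomialIdeal M) :
    IsLeast {A : Set (Fin n →₀ ℕ) | monomialSpan k A = M} (minimalGenerators M) := by
  refine ⟨le_antisymm ?_ ?_, ?_⟩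
  · refine Ideal.span_le.2 ?_
    rintro _ ⟨a, ha, rfl⟩
    exact ha.1
  · obtain ⟨A, rfl⟩ := hM
    refine Ideal.span_le.2 ?_
    rintro _ ⟨a, ha, rfl⟩
    have h : monomial a (1 : k) ∈ monomialSpan k A := mem_monomialSpan_iff.2 ⟨a, ha, le_rfl⟩
    obtain ⟨b, hba, hb⟩ := exists_minimal_le_of_wellFoundedLT
      (fun b => monomial b (1 : k) ∈ monomialSpan k A) a h
    exact mem_monomialSpan_iff.2 ⟨b, hb, hba⟩
  · rintro A rfl a ha
    obtain ⟨b, hb, hba⟩ := mem_monomialSpan_iff.1 ha.1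
    have h := ha.2 (mem_monomialSpan_iff.2 ⟨b, hb, le_rfl⟩) hba
    exact le_antisymm hba h ▸ hb

/-- The monomial `m` is dominant in `L`: there is a variable `x` whose exponent in `m` is larger
than its exponent in every other element of `L`. -/
def IsDominantIn {n : ℕ} (L : Set (Fin n →₀ ℕ)) (m : Fin n →₀ ℕ) : Prop :=
  ∃ x : Fin n, ∀ m' ∈ L, m' ≠ m → m' x < m x

/-- A set of monomials is dominant if each of its elements is dominant in it. -/
def IsDominantSet {n : ℕ} (L : Set (Fin n →₀ ℕ)) : Prop :=
  ∀ m ∈ L, IsDominantIn L m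

/-- The monomial `a` strongly divides the monomial `b`. -/
def StronglyDivides {n : ℕ} (a b : Fin n →₀ ℕ) : Prop :=
  ∀ i, a i ≠ 0 → a i < b i

/-- The least common multiple of a finite set of monomials (which is `1` for the empty set). -/
def monomialLcm {n : ℕ} (D : Finset (Fin n →₀ ℕ)) : Fin n →₀ ℕ :=
  D.sup id

/-- The class of the dominant subsets `D` of cardinality `n` of the minimal generating set of `M`
such that no minimal generator of `M` strongly divides `monomialLcm D`. -/
def dominantClass {n : ℕ} {k : Type*} [Field k] (M : Ideal (MvPolynomial (Fin n) k)) :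
    Set (Finset (Fin n →₀ ℕ)) :=
  {D | (D : Set (Fin n →₀ ℕ)) ⊆ minimalGenerators M ∧ IsDominantSet (D : Set (Fin n →₀ ℕ)) ∧
    D.card = n ∧ ∀ g ∈ minimalGenerators M, ¬ StronglyDivides g (monomialLcm D)}

/-- A multigraded free resolution `⋯ → F₂ → F₁ → F₀ → S/M → 0`, where `S = k[x₁, …, xₙ]`. The module
`Fᵢ` is the free `S`-module with basis `basis i`, each basis element has a multidegree, and all
maps preserve multidegrees. -/
structure MultigradedFreeResolution {n : ℕ} {k : Type u} [Field k]
    (M : Ideal (MvPolynomial (Fin n) k)) where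
  /-- The basis elements of homological degree `i`. -/
  basis : ℕ → Type v
  /-- The multidegree of a basis element. -/
  mdeg : ∀ {i : ℕ}, basis i → (Fin n →₀ ℕ)
  /-- The differential `Fᵢ₊₁ → Fᵢ`. -/
  d : ∀ i : ℕ, (basis (i + 1) →₀ MvPolynomial (Fin n) k) →ₗ[MvPolynomial (Fin n) k]
    (basis i →₀ MvPolynomial (Fin n) k)
  /-- The augmentation `F₀ → S/M`. -/
  aug : (basis 0 →₀ MvPolynomial (Fin n) k) →ₗ[MvPolynomial (Fin n) k]
    (MvPolynomial (Fin n) k ⧸ M)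
  /-- Every monomial `m` of the coefficient of `[τ]` in `d [σ]` satisfies
  `m * mdeg [τ] = mdeg [σ]`. -/
  d_homogeneous : ∀ (i : ℕ) (σ : basis (i + 1)) (τ : basis i),
    ∀ m ∈ (d i (Finsupp.single σ 1) τ).support, m + mdeg τ = mdeg σ
  /-- The image of `[σ]` in `S/M` is the class of a scalar multiple of the monomial `mdeg [σ]`. -/
  aug_homogeneous : ∀ σ : basis 0, ∃ c : k,
    aug (Finsupp.single σ 1) = Ideal.Quotient.mk M (monomial (mdeg σ) c)
  aug_surjective : Function.Surjective aug
  exact_zero : Function.Exact (d 0) aug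
  exact_succ : ∀ i : ℕ, Function.Exact (d (i + 1)) (d i)

/-- A resolution is minimal if its differential matrices have no invertible entries. -/
def MultigradedFreeResolution.IsMinimal {n : ℕ} {k : Type u} [Field k]
    {M : Ideal (MvPolynomial (Fin n) k)} (F : MultigradedFreeResolution.{u, v} M) : Prop :=
  ∀ (i : ℕ) (σ : F.basis (i + 1)) (τ : F.basis i), ¬ IsUnit (F.d i (Finsupp.single σ 1) τ)

/-- The number of basis elements of homological degree `i` and multidegree `l`. When `F` is a
minimal resolution of `S/M`, this is the multigraded Betti number of `S/M` in homological degree `i`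
and multidegree `l`. -/
def MultigradedFreeResolution.betti {n : ℕ} {k : Type u} [Field k]
    {M : Ideal (MvPolynomial (Fin n) k)} (F : MultigradedFreeResolution.{u, v} M)
    (i : ℕ) (l : Fin n →₀ ℕ) : ℕ∞ :=
  {σ : F.basis i | F.mdeg σ = l}.encard

/-- The multigraded Betti number of `S/M` in homological degree `i` and multidegree `l` is
(well defined and) equal to `b`: the module `S/M` has a minimal multigraded free resolution, and
each of them has exactly `b` basis elements of homological degree `i` and multidegree `l`. -/
def MultigradedBettiEq {n : ℕ} {k : Type u} [Field k]
    (M : Ideal (MvPolynomial (Fin n) k)) (i : ℕ) (l : Fin n →₀ ℕ) (b : ℕ∞) : Prop :=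
  (∃ F : MultigradedFreeResolution.{u, v} M, F.IsMinimal) ∧
    ∀ F : MultigradedFreeResolution.{u, v} M, F.IsMinimal → F.betti i l = b

end

end MonomialResolution

/-! The number in question is the dimension of `Tor_n(S/M, k)` in degree `l`. Computed with the
Koszul complex, this is the socle of `S/M` in degree `l - (1, …, 1)`: it has dimension 1 if the
monomial with exponents `l - 1` lies outside `M` while each of its products with a variable lies in
`M`, and dimension 0 otherwise. Generators `m_i` that witness the membership of the product with
`x_i` have exponent exactly `l_i` at `x_i` and exponents below `l_j` at every other `x_j`. They form
a dominant set of size `n` with lcm `l`, and no generator strongly divides `l` because `l - 1` is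
outside `M`. The converse reads the same conditions backwards (`exists_mem_dominantClass_iff`).

The Koszul argument is run inside the resolution. Setting the variables to 1 gives a complex of
vector spaces whose basis elements keep their multidegrees. For a set `A` of variables, the
subquotient on the degrees `≤ l` that agree with `l` on `A` (`slab`) computes the Koszul homology of
`S/M` on the variables in `A`, in degree `l`. For `A = ∅` it is the strand of the resolution in
degree `l`, whose only homology is that of `S/M` (`exists_detects`). Adding a variable `b` to `A`
gives a short exact sequence of subquotients, whose long exact sequence identifies the new top
homology with the kernel of multiplication by `x_b` on the old one (`Detects.insert`). When `A`
contains all variables only degree `l` is left; minimality makes the differential zero there, so the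
homology counts basis elements (`encard_eq_of_detects`).

A minimal resolution exists because kernels of homogeneous maps are homogeneous and finitely
generated, and a homogeneous generating set of least cardinality has no relation with a unit
coefficient (`exists_minimal_cover`). -/

namespace MonomialResolution

noncomputable section

/-! ### Projections onto sets of degrees -/

/-- The projection of the free module on `ι` onto the span of the basis elements whose degree lies
in `T`. -/
def degProj {ι : Type*} {D : Type*} (k : Type*) [Field k] (deg : ι → D) (T : Set D) :
    (ι →₀ k) →ₗ[k] (ι →₀ k) where
  toFun x := by classical exact x.filter (fun σ => deg σ ∈ T)
  map_add' x y := by classical exact Finsupp.filter_add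
  map_smul' c x := by classical exact Finsupp.filter_smul

section degProj

variable {ι D k : Type*} [Field k] (deg : ι → D)

open Classical in
theorem degProj_apply (T : Set D) (x : ι →₀ k) (σ : ι) :
    degProj k deg T x σ = if deg σ ∈ T then x σ else 0 :=
  Finsupp.filter_apply _ _ _

theorem degProj_degProj (T U : Set D) (x : ι →₀ k) :
    degProj k deg T (degProj k deg U x) = degProj k deg (T ∩ U) x := by
  classical
  ext σ
  simp only [degProj_apply, Set.mem_inter_iff]
  split_ifs <;> tauto

theorem degProj_union {T U : Set D} (h : Disjoint T U) (x : ι →₀ k) :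
    degProj k deg (T ∪ U) x = degProj k deg T x + degProj k deg U x := by
  classical
  ext σ
  simp only [degProj_apply, Set.mem_union, Finsupp.add_apply]
  by_cases h1 : deg σ ∈ T
  · simp [h1, Set.disjoint_left.1 h h1]
  · simp [h1]

theorem degProj_eq_self_iff {T : Set D} {x : ι →₀ k} :
    degProj k deg T x = x ↔ ∀ σ, x σ ≠ 0 → deg σ ∈ T := by
  classical
  simp only [Finsupp.ext_iff, degProj_apply]
  refine forall_congr' fun σ => ?_
  split_ifs with h <;> simp [h, eq_comm]

theorem degProj_degProj_of_subset {T U : Set D} (h : T ⊆ U) (x : ι →₀ k) :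
    degProj k deg U (degProj k deg T x) = degProj k deg T x := by
  rw [degProj_degProj, Set.inter_eq_right.2 h]

theorem degProj_degProj_of_subset' {T U : Set D} (h : T ⊆ U) (x : ι →₀ k) :
    degProj k deg T (degProj k deg U x) = degProj k deg T x := by
  rw [degProj_degProj, Set.inter_eq_left.2 h]

theorem degProj_degProj_of_disjoint {T U : Set D} (h : Disjoint T U) (x : ι →₀ k) :
    degProj k deg T (degProj k deg U x) = 0 := by
  classical
  rw [degProj_degProj, Set.disjoint_iff_inter_eq_empty.1 h]
  ext σ
  simp [degProj_apply]

theorem degProj_univ (x : ι →₀ k) : degProj k deg Set.univ x = x := by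
  classical
  ext σ
  simp [degProj_apply]

end degProj

/-! ### Subquotients of a filtered complex and their long exact sequence -/

/-- A chain complex of vector spaces with bases, in which each basis element has a degree in a
partially ordered set and the differential does not increase degrees. -/
structure BasedComplex (k : Type u) [Field k] (D : Type*) [PartialOrder D] where
  /-- The basis elements of homological degree `i`. -/
  basis : ℕ → Type v
  /-- The degree of a basis element. -/
  deg : ∀ {i : ℕ}, basis i → D
  /-- The differential. -/
  d : ∀ i : ℕ, (basis (i + 1) →₀ k) →ₗ[k] (basis i →₀ k)
  d_d : ∀ (i : ℕ) (x : basis (i + 1 + 1) →₀ k), d i (d (i + 1) x) = 0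
  deg_le : ∀ (i : ℕ) (σ : basis (i + 1)) (τ : basis i),
    d i (Finsupp.single σ 1) τ ≠ 0 → deg τ ≤ deg σ

namespace BasedComplex

variable {k : Type u} [Field k] {D : Type*} [PartialOrder D] (C : BasedComplex.{u, v} k D)

/-- The projection onto the span of the basis elements of degree in `T`. -/
abbrev proj {i : ℕ} (T : Set D) : (C.basis i →₀ k) →ₗ[k] (C.basis i →₀ k) :=
  degProj k C.deg T

/-- `x` is a cycle of the subquotient spanned by the basis elements of degree in `T`. -/
def IsCycle (T : Set D) (i : ℕ) (x : C.basis (i + 1) →₀ k) : Prop :=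
  C.proj T x = x ∧ C.proj T (C.d i x) = 0

/-- `x` is a boundary of the subquotient spanned by the basis elements of degree in `T`. -/
def IsBoundary (T : Set D) (i : ℕ) (x : C.basis i →₀ k) : Prop :=
  ∃ w, C.proj T w = w ∧ C.proj T (C.d i w) = x

variable {C}

theorem proj_d_proj_eq_zero {T U : Set D} (h : ∀ t ∈ T, ∀ u ∈ U, ¬ t ≤ u) (i : ℕ)
    (x : C.basis (i + 1) →₀ k) : C.proj T (C.d i (C.proj U x)) = 0 := by
  classical
  suffices H : C.proj T ∘ₗ C.d i ∘ₗ C.proj U = 0 from LinearMap.congr_fun H x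
  refine Finsupp.lhom_ext' fun σ => LinearMap.ext_ring ?_
  ext τ
  simp only [LinearMap.comp_apply, Finsupp.lsingle_apply, LinearMap.zero_apply,
    Finsupp.zero_apply, degProj_apply]
  by_cases hσ : C.deg σ ∈ U
  · have : C.proj U (Finsupp.single σ (1 : k)) = Finsupp.single σ 1 := by
      rw [degProj_eq_self_iff]
      intro τ hτ
      by_cases hστ : σ = τ
      · exact hστ ▸ hσ
      · simp [hστ] at hτ
    rw [this]
    split_ifs with hτ
    · by_contra hne
      exact h _ hτ _ hσ (C.deg_le i σ τ hne)
    · rfl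
  · have : C.proj U (Finsupp.single σ (1 : k)) = 0 := by
      ext τ
      simp only [degProj_apply, Finsupp.single_apply, Finsupp.zero_apply]
      split_ifs with h1 h2
      · exact absurd (h2 ▸ h1) hσ
      · rfl
      · rfl
    simp [this]

theorem proj_d_congr {T U : Set D} {i : ℕ} {x : C.basis (i + 1) →₀ k} (hx : C.proj U x = x)
    {T' : Set D} (hT : ∀ t, (∃ u ∈ U, t ≤ u) → (t ∈ T ↔ t ∈ T')) :
    C.proj T (C.d i x) = C.proj T' (C.d i x) := by
  have key : ∀ A B : Set D, (∀ t, (∃ u ∈ U, t ≤ u) → (t ∈ A ↔ t ∈ B)) →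
      C.proj A (C.d i x) = C.proj (A ∩ B) (C.d i x) := by
    intro A B hAB
    have h1 : A = (A ∩ B) ∪ (A \ B) := (Set.inter_union_sdiff A B).symm
    conv_lhs => rw [h1, degProj_union _ (Set.disjoint_left.2 fun t h h' => h'.2 h.2)]
    rw [← hx, proj_d_proj_eq_zero (T := A \ B) fun t ht u hu htu =>
      ht.2 ((hAB t ⟨u, hu, htu⟩).1 ht.1), add_zero]
  rw [key T T' hT, key T' T fun t ht => (hT t ht).symm, Set.inter_comm]

/-- This makes the span of the degrees in an order-convex set a complex: the part of `d x` outside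
`T` lies below `T`, and a second differential cannot bring it back into `T` without violating
convexity. -/
theorem proj_d_proj_d {T : Set D} (hT : T.OrdConnected) {i : ℕ} {x : C.basis (i + 1 + 1) →₀ k}
    (hx : C.proj T x = x) : C.proj T (C.d i (C.proj T (C.d (i + 1) x))) = 0 := by
  have h1 : C.d (i + 1) x = C.proj T (C.d (i + 1) x) + C.proj Tᶜ (C.d (i + 1) x) := by
    rw [← degProj_union _ disjoint_compl_right, Set.union_compl_self, degProj_univ]
  have h2 : C.proj Tᶜ (C.d (i + 1) x) = C.proj (Tᶜ ∩ {t | ∃ u ∈ T, t ≤ u}) (C.d (i + 1) x) :=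
    proj_d_congr hx fun t ht => ⟨fun h => ⟨h, ht⟩, fun h => h.1⟩
  have h3 := congrArg (C.proj T) (C.d_d i x)
  have h4 : C.proj T (C.d i (C.proj (Tᶜ ∩ {t | ∃ u ∈ T, t ≤ u}) (C.d (i + 1) x))) = 0 := by
    refine proj_d_proj_eq_zero ?_ _ _
    rintro t ht u ⟨hu, t', ht', hut'⟩ htu
    exact hu (hT.out ht ht' ⟨htu, hut'⟩)
  rwa [h1, map_add, map_add, h2, h4, add_zero, map_zero] at h3

theorem IsBoundary.zero (T : Set D) (i : ℕ) : C.IsBoundary T i 0 := ⟨0, by simp, by simp⟩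

/-- A decomposition `T = L ∪ U` of a set of degrees such that no element of `U` is below an element
of `L`. -/
structure IsSplit (T L U : Set D) : Prop where
  ordConnected : T.OrdConnected
  union : T = L ∪ U
  not_le : ∀ u ∈ U, ∀ t ∈ L, ¬ u ≤ t

namespace IsSplit

variable {T L U : Set D} (h : IsSplit T L U)
include h

theorem disjoint : Disjoint L U := Set.disjoint_left.2 fun t h1 h2 => h.not_le t h2 t h1 le_rfl

theorem subset_left : L ⊆ T := h.union ▸ Set.subset_union_left

theorem subset_right : U ⊆ T := h.union ▸ Set.subset_union_right

theorem proj_eq {i : ℕ} (x : C.basis i →₀ k) : C.proj T x = C.proj L x + C.proj U x := by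
  rw [h.union, degProj_union _ h.disjoint]

/-- `v ↦ C.proj L (C.d i v)` is the connecting map from the homology of `U` to that of `L`. Its
composite with the map to the homology of `T` is zero. -/
theorem isBoundary_connecting {i : ℕ} {v : C.basis (i + 1) →₀ k}
    (hv : C.IsCycle U i v) : C.IsBoundary T i (C.proj L (C.d i v)) := by
  refine ⟨v, ?_, ?_⟩
  · rw [← hv.1, degProj_degProj_of_subset _ h.subset_right]
  · rw [h.proj_eq, hv.2, add_zero]

theorem isCycle_connecting {i : ℕ} {v : C.basis (i + 1 + 1) →₀ k}
    (hv : C.IsCycle U (i + 1) v) : C.IsCycle L i (C.proj L (C.d (i + 1) v)) := by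
  refine ⟨degProj_degProj_of_subset _ subset_rfl _, ?_⟩
  have h1 : C.proj T v = v := by rw [← hv.1, degProj_degProj_of_subset _ h.subset_right]
  have h2 := congrArg (C.proj L) (proj_d_proj_d h.ordConnected h1)
  rwa [h.proj_eq (C.d (i + 1) v), hv.2, add_zero, degProj_degProj_of_subset' _ h.subset_left,
    map_zero] at h2

/-- Exactness of the long sequence at the homology of `L`: if `u = d z` in `T`, the `U`-part of `z`
is the required cycle and its `L`-part bounds the difference. -/
theorem exists_connecting {i : ℕ} {u : C.basis i →₀ k}
    (hu : C.proj L u = u) (hb : C.IsBoundary T i u) :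
    ∃ v, C.IsCycle U i v ∧ C.IsBoundary L i (u - C.proj L (C.d i v)) := by
  obtain ⟨z, hz, rfl⟩ := hb
  have hz' : z = C.proj L z + C.proj U z := by rw [← h.proj_eq, hz]
  have hd : C.d i z = C.d i (C.proj L z) + C.d i (C.proj U z) := by rw [← map_add, ← hz']
  refine ⟨C.proj U z, ⟨degProj_degProj_of_subset _ subset_rfl _, ?_⟩, C.proj L z,
    degProj_degProj_of_subset _ subset_rfl _, ?_⟩
  · have h1 := congrArg (C.proj U) hu
    rw [degProj_degProj_of_disjoint _ h.disjoint.symm,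
      degProj_degProj_of_subset' _ h.subset_right, hd, map_add,
      proj_d_proj_eq_zero h.not_le, zero_add] at h1
    exact h1.symm
  · rw [← hu, degProj_degProj_of_subset' _ h.subset_left, hd, map_add]
    abel

/-- The connecting map is well defined on homology classes. -/
theorem isBoundary_left {i : ℕ} {v : C.basis (i + 1) →₀ k}
    (hv : C.IsBoundary U (i + 1) v) : C.IsBoundary L i (C.proj L (C.d i v)) := by
  obtain ⟨z, hz, rfl⟩ := hv
  have hzT : C.proj T z = z := by rw [← hz, degProj_degProj_of_subset _ h.subset_right]
  refine ⟨-C.proj L (C.d (i + 1) z), ?_, ?_⟩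
  · rw [map_neg, degProj_degProj_of_subset _ subset_rfl]
  · have h1 := congrArg (C.proj L) (proj_d_proj_d h.ordConnected hzT)
    rw [degProj_degProj_of_subset' _ h.subset_left, h.proj_eq, map_add, map_add, map_zero] at h1
    rw [map_neg, map_neg]
    exact (eq_neg_of_add_eq_zero_right h1).symm

/-- The connecting map is injective where `T` has no homology: correcting `v` by a chain of `L`
yields a cycle of `T`. -/
theorem isBoundary_right {i : ℕ} {v : C.basis (i + 1) →₀ k} (hv : C.IsCycle U i v)
    (hb : C.IsBoundary L i (C.proj L (C.d i v)))
    (hT : ∀ x, C.IsCycle T i x → C.IsBoundary T (i + 1) x) : C.IsBoundary U (i + 1) v := by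
  obtain ⟨w, hw, hwv⟩ := hb
  have hwT : C.proj T w = w := by rw [← hw, degProj_degProj_of_subset _ h.subset_left]
  have hvT : C.proj T v = v := by rw [← hv.1, degProj_degProj_of_subset _ h.subset_right]
  have hUw : C.proj U (C.d i w) = 0 := by rw [← hw, proj_d_proj_eq_zero h.not_le]
  obtain ⟨z, hz, hzv⟩ := hT (v - w) ⟨by rw [map_sub, hwT, hvT], by
    rw [map_sub, map_sub, h.proj_eq, h.proj_eq, hv.2, hUw, hwv, sub_self]⟩
  refine ⟨C.proj U z, degProj_degProj_of_subset _ subset_rfl _, ?_⟩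
  have hz' : z = C.proj L z + C.proj U z := by rw [← h.proj_eq, hz]
  have h1 := congrArg (C.proj U) hzv
  rw [degProj_degProj_of_subset' _ h.subset_right, map_sub, hv.1, ← hw,
    degProj_degProj_of_disjoint _ h.disjoint.symm, sub_zero, hz', map_add, map_add,
    proj_d_proj_eq_zero h.not_le, zero_add] at h1
  exact h1

end IsSplit

end BasedComplex

/-! ### Koszul homology by adding one variable at a time -/

/-- The degrees below `l` that agree with `l` at the variables in `A`. -/
def slab {n : ℕ} (A : Finset (Fin n)) (l : Fin n → ℤ) : Set (Fin n → ℤ) :=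
  {x | x ≤ l ∧ ∀ a ∈ A, x a = l a}

/-- The exponent vector of the product of the variables in `A`. -/
def indicatorDegree {n : ℕ} (A : Finset (Fin n)) : Fin n → ℤ :=
  fun i => if i ∈ A then 1 else 0

theorem indicatorDegree_insert {n : ℕ} {A : Finset (Fin n)} {b : Fin n} (hb : b ∉ A) :
    indicatorDegree (insert b A) = indicatorDegree A + Pi.single b 1 := by
  ext i
  by_cases h : i = b
  · subst h; simp [indicatorDegree, hb]
  · simp [indicatorDegree, h]

namespace BasedComplex

/-- The two parts are distinguished by whether the coordinate at `b` is less than or equal to that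
of `l`. The inclusion of the lower part plays the role of multiplication by `x_b`. -/
theorem isSplit_slab {n : ℕ} {A : Finset (Fin n)} {b : Fin n} (hb : b ∉ A) (l : Fin n → ℤ) :
    IsSplit (slab A l) (slab A (l - Pi.single b 1)) (slab (insert b A) l) where
  ordConnected := by
    refine ⟨fun x hx z hz y hy => ⟨hy.2.trans hz.1, fun a ha => le_antisymm ?_ ?_⟩⟩
    · exact (hy.2 a).trans_eq (hz.2 a ha)
    · exact (hx.2 a ha).symm.trans_le (hy.1 a)
  union := by
    ext x
    have hA : ∀ a ∈ A, (l - Pi.single b 1 : Fin n → ℤ) a = l a := fun a ha => by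
      have : a ≠ b := fun h => hb (h ▸ ha)
      simp [this]
    have hle : x ≤ l - Pi.single b 1 ↔ x ≤ l ∧ x b < l b := by
      constructor
      · intro h
        have h0 : (0 : Fin n → ℤ) ≤ Pi.single b 1 := by
          rw [Pi.le_def]; intro i; by_cases hi : i = b
          · subst hi; simp
          · simp [hi]
        refine ⟨h.trans (sub_le_self _ h0), ?_⟩
        have := h b
        simp at this
        omega
      · rintro ⟨h1, h2⟩ i
        by_cases hi : i = b
        · subst hi; simp; omega
        · simpa [hi] using h1 i
    simp only [slab, Set.mem_union, Set.mem_ofPred_eq, hle, Finset.mem_insert, forall_eq_or_imp]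
    constructor
    · rintro ⟨h1, h2⟩
      rcases (h1 b).lt_or_eq with h | h
      · exact Or.inl ⟨⟨h1, h⟩, fun a ha => (h2 a ha).trans (hA a ha).symm⟩
      · exact Or.inr ⟨h1, h, h2⟩
    · rintro (⟨⟨h1, -⟩, h3⟩ | ⟨h1, -, h3⟩)
      · exact ⟨h1, fun a ha => (h3 a ha).trans (hA a ha)⟩
      · exact ⟨h1, h3⟩
  not_le := by
    intro u hu t ht hut
    have h1 : u b = l b := hu.2 b (Finset.mem_insert_self _ _)
    have h2 := ht.1 b
    have h3 : u b ≤ t b := hut b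
    simp only [Pi.sub_apply, Pi.single_eq_same] at h2
    omega

variable {n : ℕ} {k : Type u} [Field k] (C : BasedComplex.{u, v} k (Fin n → ℤ))

/-- The subquotients of `C` spanned by the basis elements of degree in `slab A l` are exact above
degree `j`, and `φ` identifies their homology at `j` with the elements of degree
`l - indicatorDegree A` of `S/M` that are annihilated by the variables in `A`; here `N` is the set
of the degrees in which `S/M` does not vanish. -/
structure Detects (N : (Fin n → ℤ) → Prop) (A : Finset (Fin n)) (j : ℕ)
    (φ : (Fin n → ℤ) → (C.basis (j + 1) →₀ k) →ₗ[k] k) : Prop where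
  exact : ∀ l i x, j < i → C.IsCycle (slab A l) i x → C.IsBoundary (slab A l) (i + 1) x
  eq_zero_iff : ∀ l x, C.IsCycle (slab A l) j x →
    (φ l x = 0 ↔ C.IsBoundary (slab A l) (j + 1) x)
  exists_ne : ∀ l, (∃ x, C.IsCycle (slab A l) j x ∧ φ l x ≠ 0) ↔
    N (l - indicatorDegree A) ∧ ∀ a ∈ A, ¬ N (l - indicatorDegree A + Pi.single a 1)
  compat : ∀ l, ∀ b ∉ A, N (l - indicatorDegree A) →
    ∀ x, C.IsCycle (slab A (l - Pi.single b 1)) j x → φ l x = φ (l - Pi.single b 1) x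

variable {C}

/-- The new functional is the old one, in degree `l - e_b`, composed with the connecting map. That
map is injective on homology since `slab A l` is exact above `j`, and its image consists of the
classes that die in `slab A l`, that is, those killed by `x_b`. -/
theorem Detects.insert {N : (Fin n → ℤ) → Prop} {A : Finset (Fin n)} {j : ℕ}
    {φ : (Fin n → ℤ) → (C.basis (j + 1) →₀ k) →ₗ[k] k} (h : C.Detects N A j φ) {b : Fin n}
    (hb : b ∉ A) :
    C.Detects N (insert b A) (j + 1) fun l => φ (l - Pi.single b 1) ∘ₗ
      C.proj (slab A (l - Pi.single b 1)) ∘ₗ C.d (j + 1) where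
  exact l i x hi hx := by
    obtain ⟨i, rfl⟩ : ∃ i', i = i' + 1 := ⟨i - 1, by omega⟩
    have hs := isSplit_slab hb l
    exact hs.isBoundary_right hx (h.exact _ _ _ (by omega) (hs.isCycle_connecting hx))
      fun y hy => h.exact _ _ _ (by omega) hy
  eq_zero_iff l x hx := by
    have hs := isSplit_slab hb l
    simp only [LinearMap.comp_apply]
    rw [h.eq_zero_iff _ _ (hs.isCycle_connecting hx)]
    exact ⟨fun H => hs.isBoundary_right hx H fun y hy => h.exact _ _ _ (by omega) hy,
      fun H => hs.isBoundary_left H⟩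
  exists_ne l := by
    have hs := isSplit_slab hb l
    have hA := h.exists_ne (l - Pi.single b 1)
    have e1 : l - indicatorDegree (Insert.insert b A) = l - Pi.single b 1 - indicatorDegree A := by
      rw [indicatorDegree_insert hb]; abel
    have e2 : l - Pi.single b 1 - indicatorDegree A + Pi.single b 1 = l - indicatorDegree A := by
      abel
    rw [e1]
    simp only [Finset.mem_insert, forall_eq_or_imp, e2]
    simp only [LinearMap.comp_apply]
    constructor
    · rintro ⟨x, hx, hne⟩
      have hc := hs.isCycle_connecting hx
      obtain ⟨h1, h2⟩ := hA.1 ⟨_, hc, hne⟩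
      refine ⟨h1, fun hN => hne ?_, h2⟩
      -- If `N` held at `l - indicatorDegree A`, the functionals of degrees `l` and `l - e_b` would
      -- agree on the connecting image, which bounds in `slab A l`.
      rw [← h.compat l b hb hN _ hc, h.eq_zero_iff]
      · exact hs.isBoundary_connecting hx
      · refine ⟨degProj_degProj_of_subset _ hs.subset_left _, ?_⟩
        have := proj_d_proj_d (C := C) hs.ordConnected (x := x)
          (by rw [← hx.1, degProj_degProj_of_subset _ hs.subset_right])
        rwa [hs.proj_eq (C.d (j + 1) x), hx.2, add_zero] at this
    · rintro ⟨h1, hN, h2⟩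
      obtain ⟨u, hu, hne⟩ := hA.2 ⟨h1, h2⟩
      have huT : C.IsCycle (slab A l) j u := by
        refine ⟨by rw [← hu.1, degProj_degProj_of_subset _ hs.subset_left], ?_⟩
        rw [hs.proj_eq, hu.2, zero_add, ← hu.1, proj_d_proj_eq_zero hs.not_le]
      -- As `N` fails at `l - indicatorDegree A`, every cycle of `slab A l` bounds. Hence `u` comes,
      -- up to a boundary, from the connecting map.
      have hub : C.IsBoundary (slab A l) (j + 1) u := by
        rw [← h.eq_zero_iff _ _ huT]
        by_contra hne'
        exact hN ((h.exists_ne l).1 ⟨u, huT, hne'⟩).1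
      obtain ⟨v, hv, hbd⟩ := hs.exists_connecting hu.1 hub
      refine ⟨v, hv, ?_⟩
      have hc : C.IsCycle (slab A (l - Pi.single b 1)) j
          (u - C.proj (slab A (l - Pi.single b 1)) (C.d (j + 1) v)) := by
        have := hs.isCycle_connecting hv
        exact ⟨by rw [map_sub, hu.1, this.1], by rw [map_sub, map_sub, hu.2, this.2, sub_zero]⟩
      have h0 := (h.eq_zero_iff _ _ hc).2 hbd
      rw [map_sub, sub_eq_zero] at h0
      rwa [← h0]
  compat l c hc hN x hx := by
    have hcb : c ≠ b := fun H => hc (H ▸ Finset.mem_insert_self _ _)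
    have hcA : c ∉ A := fun H => hc (Finset.mem_insert_of_mem H)
    have e1 : l - indicatorDegree (Insert.insert b A) = l - Pi.single b 1 - indicatorDegree A := by
      rw [indicatorDegree_insert hb]; abel
    have e2 : l - Pi.single c 1 - Pi.single b 1 = l - Pi.single b 1 - Pi.single c (1 : ℤ) := by
      abel
    have hcyc := (isSplit_slab hb (l - Pi.single c 1)).isCycle_connecting hx
    rw [e2] at hcyc
    simp only [LinearMap.comp_apply, e2]
    rw [← h.compat _ c hcA (e1 ▸ hN) _ hcyc]
    congr 1
    refine proj_d_congr hx.1 ?_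
    rintro t ⟨u, hu, htu⟩
    have ht : t c ≤ l c - 1 := by simpa using (htu.trans hu.1) c
    have hs := (isSplit_slab hcA (l - Pi.single b 1)).union
    -- Degrees below `l - e_c` miss the part of the slab where the coordinate at `c` equals `l c`,
    -- so both projections agree.
    rw [hs, Set.mem_union, or_iff_left]
    rintro ⟨-, h2⟩
    have := h2 c (Finset.mem_insert_self _ _)
    simp [hcb] at this
    omega

theorem Detects.exists_of_empty {N : (Fin n → ℤ) → Prop}
    {φ : (Fin n → ℤ) → (C.basis (0 + 1) →₀ k) →ₗ[k] k} (h : C.Detects N ∅ 0 φ)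
    (A : Finset (Fin n)) : ∃ ψ, C.Detects N A A.card ψ := by
  induction A using Finset.induction_on with
  | empty => exact ⟨φ, h⟩
  | insert b A hb ih =>
    obtain ⟨ψ, hψ⟩ := ih
    rw [Finset.card_insert_of_notMem hb]
    exact ⟨_, hψ.insert hb⟩

theorem slab_univ (l : Fin n → ℤ) : slab Finset.univ l = {l} := by
  ext x
  simp only [slab, Finset.mem_univ, forall_const, Set.mem_ofPred_eq, Set.mem_singleton_iff]
  exact ⟨fun h => funext h.2, fun h => h ▸ ⟨le_rfl, fun _ => rfl⟩⟩

open Classical in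
/-- For a minimal complex, the number of basis elements of homological degree `n` and degree `l` is
the dimension of the socle of `S/M` in degree `l - (1, …, 1)`. -/
theorem encard_eq_of_detects {N : (Fin n → ℤ) → Prop}
    {φ : (Fin n → ℤ) → (C.basis (0 + 1) →₀ k) →ₗ[k] k} (h : C.Detects N ∅ 0 φ)
    (hmin : ∀ i (σ : C.basis (i + 1)) (τ : C.basis i), C.deg σ = C.deg τ →
      C.d i (Finsupp.single σ 1) τ = 0) (l : Fin n → ℤ) :
    {σ : C.basis (n + 1) | C.deg σ = l}.encard =
      if N (l - 1) ∧ ∀ a, ¬ N (l - 1 + Pi.single a 1) then 1 else 0 := by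
  obtain ⟨ψ, hψ⟩ : ∃ ψ, C.Detects N Finset.univ n ψ := by
    have := h.exists_of_empty Finset.univ
    rwa [Finset.card_univ, Fintype.card_fin] at this
  -- In a single degree the differential of a minimal complex vanishes, so every chain is a cycle
  -- and only 0 is a boundary.
  have hmin' : ∀ i (x : C.basis (i + 1) →₀ k), C.proj {l} x = x → C.proj {l} (C.d i x) = 0 := by
    intro i x hx
    rw [degProj_eq_self_iff] at hx
    rw [← Finsupp.sum_single x, Finsupp.sum, map_sum, map_sum]
    refine Finset.sum_eq_zero fun σ hσ => ?_
    have hσl := hx σ (Finsupp.mem_support_iff.1 hσ)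
    rw [← mul_one (x σ), ← smul_eq_mul, ← Finsupp.smul_single, map_smul, map_smul]
    ext τ
    rw [Finsupp.smul_apply, degProj_apply]
    split_ifs with hτ
    · rw [hmin i σ τ (hσl.trans hτ.symm)]; simp
    · simp
  have hcyc : ∀ x : C.basis (n + 1) →₀ k, C.IsCycle (slab Finset.univ l) n x ↔
      C.proj {l} x = x := fun x => by
    rw [slab_univ]
    exact ⟨fun h => h.1, fun h => ⟨h, hmin' _ _ h⟩⟩
  have hinj : ∀ x : C.basis (n + 1) →₀ k, C.proj {l} x = x → ψ l x = 0 → x = 0 := by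
    intro x hx h0
    obtain ⟨w, hw, hwx⟩ := (hψ.eq_zero_iff l x ((hcyc x).2 hx)).1 h0
    rw [slab_univ] at hw hwx
    rw [← hwx, hmin' _ _ hw]
  have hsing : ∀ σ : C.basis (n + 1), C.deg σ = l →
      C.proj {l} (Finsupp.single σ (1 : k)) = Finsupp.single σ 1 := by
    intro σ hσ
    rw [degProj_eq_self_iff]
    intro τ hτ
    rw [Finsupp.single_apply] at hτ
    split_ifs at hτ with hστ
    · exact hστ ▸ hσ
    · exact absurd rfl hτ
  have hone : indicatorDegree (Finset.univ : Finset (Fin n)) = 1 := by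
    ext; simp [indicatorDegree]
  have hne := hψ.exists_ne l
  rw [hone] at hne
  simp only [Finset.mem_univ, forall_const, hcyc] at hne
  by_cases hx : ∃ x, C.proj {l} x = x ∧ ψ l x ≠ 0
  · rw [if_pos (hne.1 hx)]
    obtain ⟨x, hx, hx0⟩ := hx
    rw [degProj_eq_self_iff] at hx
    obtain ⟨σ, hσ⟩ : ∃ σ, x σ ≠ 0 := by
      by_contra! H
      exact hx0 (by rw [show x = 0 from Finsupp.ext H, map_zero])
    rw [Set.encard_eq_one]
    refine ⟨σ, Set.eq_singleton_iff_unique_mem.2 ⟨hx σ hσ, fun τ hτ => ?_⟩⟩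
    have hs := hsing σ (hx σ hσ)
    have ht := hsing τ hτ
    -- The injective functional `ψ l` kills this combination of two basis elements, so they cannot
    -- be distinct.
    have h0 := hinj (ψ l (Finsupp.single τ 1) • Finsupp.single σ 1 -
      ψ l (Finsupp.single σ 1) • Finsupp.single τ 1)
      (by rw [map_sub, map_smul, map_smul, hs, ht])
      (by rw [map_sub, map_smul, map_smul, smul_eq_mul, smul_eq_mul, mul_comm, sub_self])
    by_contra hne
    have h1 := DFunLike.congr_fun h0 τ
    simp [Ne.symm hne] at h1
    have h2 := hinj _ hs h1
    simp at h2
  · rw [if_neg fun H => hx (hne.2 H), Set.encard_eq_zero, Set.eq_empty_iff_forall_notMem]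
    intro σ hσ
    refine hx ⟨_, hsing σ hσ, fun h0 => ?_⟩
    have h2 := hinj _ (hsing σ hσ) h0
    simp at h2

end BasedComplex

/-! ### Homogeneous maps and their dehomogenization -/

section Homogeneous

variable {n : ℕ} {k : Type*} [Field k] {ι κ : Type*}

/-- A linear map between free modules that preserves multidegrees. -/
def IsHomogeneousMap (degι : ι → Fin n →₀ ℕ) (degκ : κ → Fin n →₀ ℕ)
    (f : (κ →₀ MvPolynomial (Fin n) k) →ₗ[MvPolynomial (Fin n) k]
      (ι →₀ MvPolynomial (Fin n) k)) : Prop :=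
  ∀ σ τ, ∀ m ∈ (f (Finsupp.single σ 1) τ).support, m + degι τ = degκ σ

open Classical in
/-- The component of multidegree `l` of an element of a free module, as a vector of scalars. -/
def degPart (deg : ι → Fin n →₀ ℕ) (l : Fin n →₀ ℕ) :
    (ι →₀ MvPolynomial (Fin n) k) →ₗ[k] (ι →₀ k) where
  toFun x := Finsupp.onFinset x.support
    (fun σ => if deg σ ≤ l then coeff (l - deg σ) (x σ) else 0) fun σ h => by
      rw [Finsupp.mem_support_iff]
      rintro h0
      simp [h0] at h
  map_add' x y := by
    ext σ
    simp only [Finsupp.onFinset_apply, Finsupp.add_apply, coeff_add]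
    split_ifs <;> simp
  map_smul' c x := by
    ext σ
    simp

open Classical in
/-- The element of multidegree `l` of a free module with a given vector of scalars. -/
def homogenize (deg : ι → Fin n →₀ ℕ) (l : Fin n →₀ ℕ) :
    (ι →₀ k) →ₗ[k] (ι →₀ MvPolynomial (Fin n) k) where
  toFun v := Finsupp.onFinset v.support
    (fun σ => if deg σ ≤ l then monomial (l - deg σ) (v σ) else 0) fun σ h => by
      rw [Finsupp.mem_support_iff]
      rintro h0
      simp [h0] at h
  map_add' x y := by
    ext σ
    simp only [Finsupp.onFinset_apply, Finsupp.add_apply, map_add]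
    split_ifs <;> simp
  map_smul' c x := by
    ext σ
    simp only [Finsupp.onFinset_apply, Finsupp.smul_apply, RingHom.id_apply]
    split_ifs <;> simp

open Classical in
theorem degPart_apply (deg : ι → Fin n →₀ ℕ) (l : Fin n →₀ ℕ)
    (x : ι →₀ MvPolynomial (Fin n) k) (σ : ι) :
    degPart deg l x σ = if deg σ ≤ l then coeff (l - deg σ) (x σ) else 0 := rfl

open Classical in
theorem homogenize_apply (deg : ι → Fin n →₀ ℕ) (l : Fin n →₀ ℕ) (v : ι →₀ k) (σ : ι) :
    homogenize deg l v σ = if deg σ ≤ l then monomial (l - deg σ) (v σ) else 0 := rfl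

/-- The dehomogenization of a homogeneous linear map. -/
def dehomogenize (degι : ι → Fin n →₀ ℕ) (degκ : κ → Fin n →₀ ℕ)
    (f : (κ →₀ MvPolynomial (Fin n) k) →ₗ[MvPolynomial (Fin n) k]
      (ι →₀ MvPolynomial (Fin n) k)) : (κ →₀ k) →ₗ[k] (ι →₀ k) :=
  Finsupp.linearCombination k fun σ => degPart degι (degκ σ) (f (Finsupp.single σ 1))

theorem finsupp_mvPolynomial_induction {p : (ι →₀ MvPolynomial (Fin n) k) → Prop}
    (x : ι →₀ MvPolynomial (Fin n) k) (zero : p 0) (add : ∀ x y, p x → p y → p (x + y))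
    (single : ∀ σ m c, p (Finsupp.single σ (monomial m c))) : p x := by
  induction x using Finsupp.induction_linear with
  | zero => exact zero
  | add x y hx hy => exact add x y hx hy
  | single σ q =>
    induction q using MvPolynomial.induction_on' with
    | monomial m c => exact single σ m c
    | add q r hq hr =>
      rw [Finsupp.single_add]
      exact add _ _ hq hr

theorem degPart_single (deg : ι → Fin n →₀ ℕ) (l : Fin n →₀ ℕ) (σ : ι) (m : Fin n →₀ ℕ) (c : k)
    [Decidable (m + deg σ = l)] :
    degPart deg l (Finsupp.single σ (monomial m c)) =
      if m + deg σ = l then Finsupp.single σ c else 0 := by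
  classical
  ext τ
  rw [degPart_apply]
  by_cases hστ : σ = τ
  · subst hστ
    by_cases h : m + deg σ = l
    · subst h
      simp
    · rw [if_neg h]
      split_ifs with h1
      · rw [Finsupp.single_eq_same, coeff_monomial, if_neg]
        · rfl
        · rintro rfl
          exact h (tsub_add_cancel_of_le h1)
      · rfl
  · split_ifs <;> simp [Finsupp.single_eq_of_ne (Ne.symm hστ)]

theorem homogenize_single {deg : ι → Fin n →₀ ℕ} {l : Fin n →₀ ℕ} {σ : ι} (h : deg σ ≤ l) (c : k) :
    homogenize deg l (Finsupp.single σ c) = Finsupp.single σ (monomial (l - deg σ) c) := by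
  classical
  ext1 τ
  rw [homogenize_apply]
  by_cases hστ : σ = τ
  · subst hστ
    simp [h]
  · simp [Finsupp.single_eq_of_ne (Ne.symm hστ)]

theorem degPart_homogenize {deg : ι → Fin n →₀ ℕ} {l : Fin n →₀ ℕ} {v : ι →₀ k}
    (hv : ∀ σ, v σ ≠ 0 → deg σ ≤ l) : degPart deg l (homogenize deg l v) = v := by
  classical
  ext σ
  rw [degPart_apply, homogenize_apply]
  split_ifs with h
  · simp
  · by_contra h0
    exact h (hv σ (Ne.symm h0))

theorem single_monomial_eq_smul (σ : ι) (m : Fin n →₀ ℕ) (c : k) :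
    Finsupp.single σ (monomial m c) =
      monomial m c • Finsupp.single σ (1 : MvPolynomial (Fin n) k) := by
  rw [Finsupp.smul_single, smul_eq_mul, mul_one]

section Map

variable {degι : ι → Fin n →₀ ℕ} {degκ : κ → Fin n →₀ ℕ}
  {f : (κ →₀ MvPolynomial (Fin n) k) →ₗ[MvPolynomial (Fin n) k] (ι →₀ MvPolynomial (Fin n) k)}

open Classical in
theorem dehomogenize_single_apply (σ : κ) (τ : ι) :
    dehomogenize degι degκ f (Finsupp.single σ 1) τ =
      if degι τ ≤ degκ σ then coeff (degκ σ - degι τ) (f (Finsupp.single σ 1) τ) else 0 := by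
  rw [dehomogenize, Finsupp.linearCombination_single, one_smul, degPart_apply]

/-- Homogeneity leaves at most one possible monomial in each matrix entry, so the entry is recovered
from its scalar. -/
theorem IsHomogeneousMap.map_single (hf : IsHomogeneousMap degι degκ f) (σ : κ) :
    f (Finsupp.single σ 1) =
      homogenize degι (degκ σ) (dehomogenize degι degκ f (Finsupp.single σ 1)) := by
  classical
  ext τ m
  rw [homogenize_apply, dehomogenize_single_apply]
  by_cases hm : m ∈ (f (Finsupp.single σ 1) τ).support
  · have h := hf σ τ m hm
    have h1 : degι τ ≤ degκ σ := h ▸ le_add_self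
    have h2 : degκ σ - degι τ = m := by rw [← h, add_tsub_cancel_right]
    rw [if_pos h1, if_pos h1, h2, coeff_monomial, if_pos rfl]
  · have h0 := notMem_support_iff.1 hm
    rw [h0]
    split_ifs with h1
    · rw [coeff_monomial]
      split_ifs with h2
      · rw [h2, h0]
      · rfl
    · simp

/-- The bound on degrees is essential: `homogenize` discards the coordinates whose degree is not
below `l`. -/
theorem IsHomogeneousMap.map_homogenize (hf : IsHomogeneousMap degι degκ f) {l : Fin n →₀ ℕ}
    {v : κ →₀ k} (hv : ∀ σ, v σ ≠ 0 → degκ σ ≤ l) :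
    f (homogenize degκ l v) = homogenize degι l (dehomogenize degι degκ f v) := by
  classical
  have hsum : v = ∑ σ ∈ v.support, v σ • Finsupp.single σ 1 := by
    conv_lhs => rw [← Finsupp.sum_single v]
    simp [Finsupp.sum]
  rw [hsum]
  simp only [map_sum, map_smul]
  refine Finset.sum_congr rfl fun σ hσ => ?_
  have hσl := hv σ (Finsupp.mem_support_iff.1 hσ)
  rw [LinearMap.map_smul_of_tower, homogenize_single hσl, single_monomial_eq_smul, map_smul,
    hf.map_single]
  congr 1
  ext1 τ
  rw [Finsupp.smul_apply, homogenize_apply, homogenize_apply]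
  by_cases h : degι τ ≤ degκ σ
  · rw [if_pos h, if_pos (h.trans hσl), smul_eq_mul, monomial_mul, one_mul,
      tsub_add_tsub_cancel hσl h]
  · rw [if_neg h, dehomogenize_single_apply, if_neg h]
    simp

theorem IsHomogeneousMap.degPart_map (hf : IsHomogeneousMap degι degκ f) (l : Fin n →₀ ℕ)
    (x : κ →₀ MvPolynomial (Fin n) k) :
    degPart degι l (f x) = dehomogenize degι degκ f (degPart degκ l x) := by
  classical
  induction x using finsupp_mvPolynomial_induction with
  | zero => simp
  | add x y hx hy => simp only [map_add, hx, hy]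
  | single σ m c =>
    rw [degPart_single, single_monomial_eq_smul, map_smul, hf.map_single]
    ext τ
    rw [degPart_apply, Finsupp.smul_apply, homogenize_apply, smul_eq_mul]
    have hc : Finsupp.single σ c = c • Finsupp.single σ (1 : k) := by simp
    by_cases h : degι τ ≤ degκ σ
    · rw [if_pos h, monomial_mul, coeff_monomial]
      by_cases hl : m + degκ σ = l
      · rw [if_pos hl, hc, map_smul, Finsupp.smul_apply, smul_eq_mul,
          if_pos (hl ▸ h.trans le_add_self), if_pos]
        rw [← hl, add_tsub_assoc_of_le h]
      · rw [if_neg hl, map_zero, Finsupp.zero_apply]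
        split_ifs with h1 h2
        · exfalso
          apply hl
          rw [← tsub_add_cancel_of_le h1, ← h2, add_assoc, tsub_add_cancel_of_le h]
        · rfl
        · rfl
    · rw [if_neg h, mul_zero, coeff_zero, ite_self]
      split_ifs
      · rw [hc, map_smul, Finsupp.smul_apply, dehomogenize_single_apply, if_neg h, smul_zero]
      · simp

end Map

theorem coeff_eq_zero_of_mem {M : Ideal (MvPolynomial (Fin n) k)} (hM : IsMonomialIdeal M)
    {p : MvPolynomial (Fin n) k} (hp : p ∈ M) {l : Fin n →₀ ℕ} (hl : monomial l (1 : k) ∉ M) :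
    coeff l p = 0 := by
  obtain ⟨A, rfl⟩ := hM
  by_contra h
  obtain ⟨a, ha, hal⟩ := mem_ideal_span_monomial_image.1 hp l (mem_support_iff.2 h)
  exact hl (mem_monomialSpan_iff.2 ⟨a, ha, hal⟩)

section Augmentation

variable {M : Ideal (MvPolynomial (Fin n) k)} {deg : ι → Fin n →₀ ℕ} {c : ι → k}
  {g : (ι →₀ MvPolynomial (Fin n) k) →ₗ[MvPolynomial (Fin n) k] (MvPolynomial (Fin n) k ⧸ M)}

theorem augmentation_apply
    (hg : ∀ σ, g (Finsupp.single σ 1) = Ideal.Quotient.mk M (monomial (deg σ) (c σ)))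
    (x : ι →₀ MvPolynomial (Fin n) k) :
    g x = Ideal.Quotient.mk M (Finsupp.linearCombination (MvPolynomial (Fin n) k)
      (fun σ => monomial (deg σ) (c σ)) x) := by
  suffices H : g = M.mkQ ∘ₗ Finsupp.linearCombination (MvPolynomial (Fin n) k)
      (fun σ => monomial (deg σ) (c σ)) from LinearMap.congr_fun H x
  refine Finsupp.lhom_ext' fun σ => LinearMap.ext_ring ?_
  simpa using hg σ

theorem coeff_linearCombination_monomial (l : Fin n →₀ ℕ) (x : ι →₀ MvPolynomial (Fin n) k) :
    coeff l (Finsupp.linearCombination (MvPolynomial (Fin n) k)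
      (fun σ => monomial (deg σ) (c σ)) x) = Finsupp.linearCombination k c (degPart deg l x) := by
  classical
  induction x using finsupp_mvPolynomial_induction with
  | zero => simp
  | add x y hx hy => simp only [map_add, coeff_add, hx, hy]
  | single σ m r =>
    rw [degPart_single, Finsupp.linearCombination_single, smul_eq_mul, monomial_mul, coeff_monomial]
    split_ifs <;> simp

theorem coeff_eq_of_augmentation_eq (hM : IsMonomialIdeal M)
    (hg : ∀ σ, g (Finsupp.single σ 1) = Ideal.Quotient.mk M (monomial (deg σ) (c σ)))
    {x : ι →₀ MvPolynomial (Fin n) k} {p : MvPolynomial (Fin n) k}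
    (hx : g x = Ideal.Quotient.mk M p) {l : Fin n →₀ ℕ} (hl : monomial l (1 : k) ∉ M) :
    coeff l p = Finsupp.linearCombination k c (degPart deg l x) := by
  rw [augmentation_apply hg, Ideal.Quotient.eq] at hx
  have := coeff_eq_zero_of_mem hM hx hl
  rw [coeff_sub, sub_eq_zero] at this
  rw [← this, coeff_linearCombination_monomial]

theorem augmentation_homogenize
    (hg : ∀ σ, g (Finsupp.single σ 1) = Ideal.Quotient.mk M (monomial (deg σ) (c σ)))
    {l : Fin n →₀ ℕ} {v : ι →₀ k} (hv : ∀ σ, v σ ≠ 0 → deg σ ≤ l) :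
    g (homogenize deg l v) =
      Ideal.Quotient.mk M (monomial l (Finsupp.linearCombination k c v)) := by
  classical
  rw [augmentation_apply hg]
  congr 1
  have hsum : v = ∑ σ ∈ v.support, Finsupp.single σ (v σ) := (Finsupp.sum_single v).symm
  rw [hsum]
  simp only [map_sum]
  refine Finset.sum_congr rfl fun σ hσ => ?_
  have hσl := hv σ (Finsupp.mem_support_iff.1 hσ)
  rw [homogenize_single hσl, Finsupp.linearCombination_single, Finsupp.linearCombination_single,
    smul_eq_mul, monomial_mul, tsub_add_cancel_of_le hσl, smul_eq_mul]

theorem augmentation_homogenize_eq_zero (hM : IsMonomialIdeal M)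
    (hg : ∀ σ, g (Finsupp.single σ 1) = Ideal.Quotient.mk M (monomial (deg σ) (c σ)))
    {l : Fin n →₀ ℕ} {v : ι →₀ k} (hv : ∀ σ, v σ ≠ 0 → deg σ ≤ l) :
    g (homogenize deg l v) = 0 ↔
      (monomial l (1 : k) ∉ M → Finsupp.linearCombination k c v = 0) := by
  rw [augmentation_homogenize hg hv, Ideal.Quotient.eq_zero_iff_mem]
  constructor
  · intro h hl
    simpa using coeff_eq_zero_of_mem hM h hl
  · intro h
    by_cases hl : monomial l (1 : k) ∈ M
    · rw [← mul_one (Finsupp.linearCombination k c v), ← C_mul_monomial]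
      exact M.mul_mem_left _ hl
    · rw [h hl, monomial_zero]
      exact M.zero_mem

end Augmentation

theorem degPart_le (deg : ι → Fin n →₀ ℕ) (l : Fin n →₀ ℕ) (x : ι →₀ MvPolynomial (Fin n) k)
    (σ : ι) (h : degPart deg l x σ ≠ 0) : deg σ ≤ l := by
  classical
  rw [degPart_apply] at h
  by_contra h1
  exact h (if_neg h1)

/-- An element of a free module is the sum of its homogeneous components. -/
theorem exists_sum_homogenize_degPart (deg : ι → Fin n →₀ ℕ)
    (x : ι →₀ MvPolynomial (Fin n) k) : ∃ L : Finset (Fin n →₀ ℕ), ∀ L', L ⊆ L' →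
      ∑ l ∈ L', homogenize deg l (degPart deg l x) = x := by
  classical
  induction x using finsupp_mvPolynomial_induction with
  | zero => exact ⟨∅, by simp⟩
  | add x y hx hy =>
    obtain ⟨L1, h1⟩ := hx
    obtain ⟨L2, h2⟩ := hy
    refine ⟨L1 ∪ L2, fun L' hL => ?_⟩
    simp only [map_add, Finset.sum_add_distrib]
    rw [h1 _ (Finset.union_subset_left hL), h2 _ (Finset.union_subset_right hL)]
  | single σ m c =>
    refine ⟨{m + deg σ}, fun L' hL => ?_⟩
    rw [Finset.sum_eq_single_of_mem _ (hL (Finset.mem_singleton_self _))]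
    · rw [degPart_single, if_pos rfl, homogenize_single le_add_self, add_tsub_cancel_right]
    · intro l _ hl
      rw [degPart_single, if_neg (Ne.symm hl), map_zero]

end Homogeneous

/-! ### The dehomogenized resolution and the socle -/

/-- An exponent vector, with integer entries. -/
def castDegree {n : ℕ} (m : Fin n →₀ ℕ) : Fin n → ℤ := fun i => m i

theorem castDegree_le {n : ℕ} {a b : Fin n →₀ ℕ} : castDegree a ≤ castDegree b ↔ a ≤ b := by
  simp [Pi.le_def, Finsupp.le_def, castDegree]

theorem castDegree_injective {n : ℕ} : Function.Injective (castDegree (n := n)) := fun a b h => by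
  ext i
  exact Int.ofNat_inj.1 (congrFun h i)

theorem exists_castDegree {n : ℕ} {l : Fin n → ℤ} (h : 0 ≤ l) : ∃ m, l = castDegree m := by
  refine ⟨Finsupp.equivFunOnFinite.symm fun i => (l i).toNat, funext fun i => ?_⟩
  have := h i
  simpa [castDegree] using this

/-- The integer degrees in which the quotient by the monomial ideal `M` does not vanish. -/
def QuotientSupport {n : ℕ} {k : Type*} [Field k] (M : Ideal (MvPolynomial (Fin n) k))
    (l : Fin n → ℤ) : Prop :=
  ∃ m, l = castDegree m ∧ monomial m (1 : k) ∉ M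

theorem quotientSupport_castDegree {n : ℕ} {k : Type*} [Field k]
    {M : Ideal (MvPolynomial (Fin n) k)} {m : Fin n →₀ ℕ} :
    QuotientSupport M (castDegree m) ↔ monomial m (1 : k) ∉ M :=
  ⟨fun ⟨_, h1, h2⟩ => castDegree_injective h1 ▸ h2, fun h => ⟨m, rfl, h⟩⟩

namespace MultigradedFreeResolution

variable {n : ℕ} {k : Type u} [Field k] {M : Ideal (MvPolynomial (Fin n) k)}
  (F : MultigradedFreeResolution.{u, v} M)

theorem isHomogeneousMap (i : ℕ) :
    IsHomogeneousMap (F.mdeg (i := i)) (F.mdeg (i := i + 1)) (F.d i) :=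
  F.d_homogeneous i

/-- The dehomogenized differential. -/
abbrev dehomD (i : ℕ) : (F.basis (i + 1) →₀ k) →ₗ[k] (F.basis i →₀ k) :=
  dehomogenize F.mdeg F.mdeg (F.d i)

theorem dehomD_dehomD (i : ℕ) (x : F.basis (i + 1 + 1) →₀ k) :
    F.dehomD i (F.dehomD (i + 1) x) = 0 := by
  suffices H : F.dehomD i ∘ₗ F.dehomD (i + 1) = 0 from LinearMap.congr_fun H x
  refine Finsupp.lhom_ext' fun σ => LinearMap.ext_ring ?_
  simp only [LinearMap.comp_apply, Finsupp.lsingle_apply, LinearMap.zero_apply]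
  conv_lhs => rw [dehomD, dehomD, dehomogenize.eq_def (f := F.d (i + 1)),
    Finsupp.linearCombination_single, one_smul, ← (F.isHomogeneousMap i).degPart_map,
    (F.exact_succ i).apply_apply_eq_zero, map_zero]

theorem mdeg_le_of_dehomD_ne (i : ℕ) (σ : F.basis (i + 1)) (τ : F.basis i)
    (h : F.dehomD i (Finsupp.single σ 1) τ ≠ 0) : F.mdeg τ ≤ F.mdeg σ := by
  classical
  rw [dehomogenize_single_apply] at h
  by_contra h1
  exact h (if_neg h1)

/-- Between basis elements of equal multidegree an entry is a constant, and a nonzero constant is a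
unit. -/
theorem dehomD_eq_zero_of_isMinimal (hF : F.IsMinimal) (i : ℕ) (σ : F.basis (i + 1))
    (τ : F.basis i) (h : F.mdeg σ = F.mdeg τ) : F.dehomD i (Finsupp.single σ 1) τ = 0 := by
  classical
  by_contra hne
  refine hF i σ τ ?_
  rw [(F.isHomogeneousMap i).map_single, homogenize_apply, if_pos h.ge, h, tsub_self]
  exact (isUnit_iff_ne_zero.2 hne).map C

/-- The dehomogenized resolution, shifted by one so that every module has a differential. -/
def toBasedComplex : BasedComplex.{u, v} k (Fin n → ℤ) where
  basis i := Nat.casesOn i PEmpty F.basis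
  deg {i} := match i with
    | 0 => fun σ => nomatch σ
    | _ + 1 => fun σ => castDegree (F.mdeg σ)
  d i := match i with
    | 0 => 0
    | i + 1 => F.dehomD i
  d_d i x := match i with
    | 0 => rfl
    | i + 1 => F.dehomD_dehomD i x
  deg_le i σ τ h := match i with
    | 0 => nomatch τ
    | i + 1 => castDegree_le.2 (F.mdeg_le_of_dehomD_ne i σ τ h)

theorem proj_eq_self_iff {i : ℕ} {l : Fin n →₀ ℕ} {x : F.basis i →₀ k} :
    F.toBasedComplex.proj (i := i + 1) (slab ∅ (castDegree l)) x = x ↔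
      ∀ σ, x σ ≠ 0 → F.mdeg σ ≤ l := by
  refine (degProj_eq_self_iff (F.toBasedComplex.deg (i := i + 1))).trans
    (forall_congr' fun σ => forall_congr' fun _ => ?_)
  rw [← castDegree_le]
  exact ⟨fun h => h.1, fun h => ⟨h, fun a ha => absurd ha (Finset.notMem_empty a)⟩⟩

theorem proj_d_of_proj_eq {i : ℕ} {l : Fin n → ℤ} {x : F.basis (i + 1) →₀ k}
    (hx : F.toBasedComplex.proj (i := i + 2) (slab ∅ l) x = x) :
    F.toBasedComplex.proj (i := i + 1) (slab ∅ l) (F.dehomD i x) = F.dehomD i x := by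
  have := BasedComplex.proj_d_congr (C := F.toBasedComplex) (i := i + 1) (T := slab ∅ l)
    (T' := Set.univ) hx fun t ⟨u, hu, htu⟩ => by simpa [slab] using htu.trans hu.1
  rw [BasedComplex.proj, BasedComplex.proj, degProj_univ] at this
  exact this

theorem eq_zero_of_proj_eq {i : ℕ} {l : Fin n → ℤ} (hl : ¬ 0 ≤ l) {x : F.basis i →₀ k}
    (hx : F.toBasedComplex.proj (i := i + 1) (slab ∅ l) x = x) : x = 0 := by
  have hx' := (degProj_eq_self_iff (F.toBasedComplex.deg (i := i + 1))).1 hx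
  ext σ
  by_contra h
  exact hl (le_trans (fun j => Int.natCast_nonneg (F.mdeg σ j)) (hx' σ h).1)

theorem exists_dehomD_eq {i : ℕ} {l : Fin n →₀ ℕ} {x : F.basis i →₀ k}
    (hx : ∀ σ, x σ ≠ 0 → F.mdeg σ ≤ l)
    (h : homogenize F.mdeg l x ∈ LinearMap.range (F.d i)) :
    ∃ w : F.basis (i + 1) →₀ k, (∀ σ, w σ ≠ 0 → F.mdeg σ ≤ l) ∧ F.dehomD i w = x := by
  obtain ⟨w, hw⟩ := h
  refine ⟨degPart F.mdeg l w, degPart_le _ _ _, ?_⟩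
  rw [← (F.isHomogeneousMap i).degPart_map, hw, degPart_homogenize hx]

open Classical in
-- The base case: the slab for `∅` is the strand of degree `l`, and exactness of the resolution
-- passes to strands. The functional is the scalar of the augmentation, set to 0 in degrees where
-- `S/M` vanishes.
theorem exists_detects (hM : IsMonomialIdeal M) :
    ∃ φ, F.toBasedComplex.Detects (QuotientSupport M) ∅ 0 φ := by
  choose c hc using F.aug_homogeneous
  obtain ⟨φ, hφ, hφ0⟩ : ∃ φ : (Fin n → ℤ) → (F.basis 0 →₀ k) →ₗ[k] k,
      (∀ l, QuotientSupport M l → φ l = Finsupp.linearCombination k c) ∧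
      ∀ l, ¬ QuotientSupport M l → φ l = 0 :=
    ⟨fun l => if QuotientSupport M l then Finsupp.linearCombination k c else 0,
      fun l hl => if_pos hl, fun l hl => if_neg hl⟩
  have hind : indicatorDegree (∅ : Finset (Fin n)) = 0 := by ext; simp [indicatorDegree]
  refine ⟨φ, ?_, ?_, ?_, ?_⟩
  · rintro l i x hi ⟨hx, hdx⟩
    obtain ⟨i, rfl⟩ : ∃ i', i = i' + 1 := ⟨i - 1, by omega⟩
    by_cases hl : 0 ≤ l
    · obtain ⟨l, rfl⟩ := exists_castDegree hl
      have hx' := F.proj_eq_self_iff.1 hx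
      have hd : F.dehomD i x = 0 := (F.proj_d_of_proj_eq hx).symm.trans hdx
      obtain ⟨w, hw, hwx⟩ := F.exists_dehomD_eq hx' (by
        rw [LinearMap.mem_range]
        refine (F.exact_succ i _).1 ?_
        rw [(F.isHomogeneousMap i).map_homogenize hx']
        exact (congrArg _ hd).trans (map_zero _))
      have hw' := F.proj_eq_self_iff.2 hw
      exact ⟨w, hw', (F.proj_d_of_proj_eq hw').trans hwx⟩
    -- No basis element has degree below an `l` with a negative entry.
    · rw [F.eq_zero_of_proj_eq hl hx]
      exact BasedComplex.IsBoundary.zero _ _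
  · rintro l x ⟨hx, -⟩
    by_cases hl : 0 ≤ l
    · obtain ⟨l, rfl⟩ := exists_castDegree hl
      have hx' := F.proj_eq_self_iff.1 hx
      have h1 := augmentation_homogenize_eq_zero hM hc hx'
      have h2 : φ (castDegree l) x = 0 ↔ F.aug (homogenize F.mdeg l x) = 0 := by
        refine Iff.trans ?_ h1.symm
        by_cases h : QuotientSupport M (castDegree l)
        · rw [hφ _ h]
          exact ⟨fun H _ => H, fun H => H (quotientSupport_castDegree.1 h)⟩
        · rw [hφ0 _ h]
          exact ⟨fun _ H => absurd (quotientSupport_castDegree.2 H) h, fun _ => rfl⟩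
      refine h2.trans ((F.exact_zero _).trans ⟨fun h => ?_, ?_⟩)
      · obtain ⟨w, hw, hwx⟩ := F.exists_dehomD_eq hx' h
        have hw' := F.proj_eq_self_iff.2 hw
        exact ⟨w, hw', (F.proj_d_of_proj_eq hw').trans hwx⟩
      · rintro ⟨w, hw, hwx⟩
        have hwx' : F.dehomD 0 w = x := (F.proj_d_of_proj_eq hw).symm.trans hwx
        refine ⟨homogenize F.mdeg l w, ?_⟩
        rw [(F.isHomogeneousMap 0).map_homogenize (F.proj_eq_self_iff.1 hw)]
        exact congrArg _ hwx'
    · rw [F.eq_zero_of_proj_eq hl hx]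
      exact ⟨fun _ => BasedComplex.IsBoundary.zero _ _, fun _ => map_zero _⟩
  · intro l
    simp only [hind, sub_zero, Finset.notMem_empty, false_imp_iff, implies_true, and_true]
    constructor
    · rintro ⟨x, -, hx⟩
      by_contra h
      exact hx (LinearMap.congr_fun (hφ0 l h) x)
    · rintro ⟨m, rfl, hm⟩
      obtain ⟨x, hx⟩ := F.aug_surjective (Ideal.Quotient.mk M (monomial m 1))
      have h1 := coeff_eq_of_augmentation_eq hM hc hx hm
      refine ⟨degPart F.mdeg m x, ⟨F.proj_eq_self_iff.2 (degPart_le _ _ _), ?_⟩, ?_⟩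
      -- Because of the index shift, the differential out of `F₀` lands in the zero module, so the
      -- cycle condition is empty.
      · ext σ
        exact nomatch σ
      · intro h2
        rw [coeff_monomial, if_pos rfl, ← hφ _ (quotientSupport_castDegree.2 hm)] at h1
        exact one_ne_zero (h1.trans h2)
  · rintro l b - hN x ⟨hx, -⟩
    rw [hind, sub_zero] at hN
    by_cases hl : 0 ≤ l - Pi.single b 1
    · obtain ⟨m, hm⟩ := exists_castDegree hl
      -- A divisor of a monomial outside `M` is outside `M`, so both functionals are the same linear
      -- combination.
      rw [hφ _ hN, hφ]
      obtain ⟨m', rfl, hm'⟩ := hN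
      rw [hm, quotientSupport_castDegree]
      obtain ⟨A, rfl⟩ := hM
      rw [mem_monomialSpan_iff] at hm' ⊢
      rintro ⟨a, ha, ham⟩
      refine hm' ⟨a, ha, ham.trans ?_⟩
      rw [← castDegree_le, ← hm]
      exact sub_le_self _ (Pi.single_nonneg.2 zero_le_one)
    · rw [F.eq_zero_of_proj_eq hl hx]
      exact (map_zero _).trans (map_zero _).symm

open Classical in
theorem betti_eq (hM : IsMonomialIdeal M) (hF : F.IsMinimal) (l : Fin n →₀ ℕ) :
    F.betti n l = if QuotientSupport M (castDegree l - 1) ∧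
      ∀ a, ¬ QuotientSupport M (castDegree l - 1 + Pi.single a 1) then 1 else 0 := by
  obtain ⟨φ, hφ⟩ := F.exists_detects hM
  rw [← BasedComplex.encard_eq_of_detects hφ ?_ (castDegree l), betti]
  · congr 1
    ext σ
    exact castDegree_injective.eq_iff.symm
  · rintro i σ τ h
    match i with
    | 0 => exact nomatch τ
    | i + 1 => exact F.dehomD_eq_zero_of_isMinimal hF i σ τ (castDegree_injective h)

end MultigradedFreeResolution

/-! ### Existence of a minimal resolution -/

variable {n : ℕ} {k : Type u} [Field k]

theorem homogenize_degPart_mem_ker {ι κ : Type*} {degι : ι → Fin n →₀ ℕ} {degκ : κ → Fin n →₀ ℕ}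
    {f : (κ →₀ MvPolynomial (Fin n) k) →ₗ[MvPolynomial (Fin n) k] (ι →₀ MvPolynomial (Fin n) k)}
    (hf : IsHomogeneousMap degι degκ f) {x : κ →₀ MvPolynomial (Fin n) k}
    (hx : x ∈ LinearMap.ker f) (l : Fin n →₀ ℕ) :
    homogenize degκ l (degPart degκ l x) ∈ LinearMap.ker f := by
  rw [LinearMap.mem_ker] at hx ⊢
  rw [hf.map_homogenize (degPart_le _ _ _), ← hf.degPart_map, hx, map_zero, map_zero]

theorem homogenize_degPart_mem_ker_augmentation {ι : Type*} {M : Ideal (MvPolynomial (Fin n) k)}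
    (hM : IsMonomialIdeal M) {deg : ι → Fin n →₀ ℕ} {c : ι → k}
    {g : (ι →₀ MvPolynomial (Fin n) k) →ₗ[MvPolynomial (Fin n) k] (MvPolynomial (Fin n) k ⧸ M)}
    (hg : ∀ σ, g (Finsupp.single σ 1) = Ideal.Quotient.mk M (monomial (deg σ) (c σ)))
    {x : ι →₀ MvPolynomial (Fin n) k} (hx : x ∈ LinearMap.ker g) (l : Fin n →₀ ℕ) :
    homogenize deg l (degPart deg l x) ∈ LinearMap.ker g := by
  rw [LinearMap.mem_ker] at hx ⊢
  rw [augmentation_homogenize_eq_zero hM hg (degPart_le _ _ _)]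
  intro hl
  rw [← coeff_eq_of_augmentation_eq hM hg (p := 0) (by rw [hx, map_zero]) hl, coeff_zero]

/-- A homogeneous submodule of a free module of finite rank is the image of a homogeneous map from
a free module of finite rank whose kernel has no coordinates that are units. -/
theorem exists_minimal_cover {ι : Type v} [Finite ι] (deg : ι → Fin n →₀ ℕ)
    (K : Submodule (MvPolynomial (Fin n) k) (ι →₀ MvPolynomial (Fin n) k))
    (hK : ∀ x ∈ K, ∀ l, homogenize deg l (degPart deg l x) ∈ K) :
    ∃ (κ : Type v) (degκ : κ → Fin n →₀ ℕ)
      (f : (κ →₀ MvPolynomial (Fin n) k) →ₗ[MvPolynomial (Fin n) k]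
        (ι →₀ MvPolynomial (Fin n) k)),
      Finite κ ∧ IsHomogeneousMap deg degκ f ∧ LinearMap.range f = K ∧
        ∀ x, f x = 0 → ∀ τ, ¬ IsUnit (x τ) := by
  classical
  let H : Set (ι →₀ MvPolynomial (Fin n) k) :=
    {y | y ∈ K ∧ ∃ l, homogenize deg l (degPart deg l y) = y}
  have hH : Submodule.span (MvPolynomial (Fin n) k) H = K := by
    refine le_antisymm (Submodule.span_le.2 fun y hy => hy.1) fun x hx => ?_
    obtain ⟨L, hL⟩ := exists_sum_homogenize_degPart deg x
    rw [← hL L subset_rfl]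
    refine Submodule.sum_mem _ fun l _ => Submodule.subset_span ⟨hK x hx l, l, ?_⟩
    rw [degPart_homogenize (degPart_le _ _ _)]
  have hfg : (Submodule.span (MvPolynomial (Fin n) k) H).FG := IsNoetherian.noetherian _
  obtain ⟨t₀, ht₀H, ht₀⟩ := (Submodule.fg_span_iff_fg_span_finset_subset H).1 hfg
  -- A homogeneous generating set of least cardinality; its elements become the images of the basis.
  obtain ⟨t, ⟨htH, htK⟩, hmin⟩ := exists_minimalFor_of_wellFoundedLT
    (fun t : Finset (ι →₀ MvPolynomial (Fin n) k) => (t : Set _) ⊆ H ∧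
      Submodule.span (MvPolynomial (Fin n) k) (t : Set _) = K) Finset.card
    ⟨t₀, ht₀H, ht₀.symm.trans hH⟩
  choose! dg hdg using fun y (hy : y ∈ H) => hy.2
  let e : ULift.{v} (Fin t.card) ≃ t := Equiv.ulift.trans t.equivFin.symm
  have hsingle : ∀ σ, Finsupp.linearCombination (MvPolynomial (Fin n) k)
      (fun σ => (e σ : ι →₀ MvPolynomial (Fin n) k)) (Finsupp.single σ 1) = e σ := fun σ => by
    rw [Finsupp.linearCombination_single, one_smul]
  refine ⟨ULift.{v} (Fin t.card), fun σ => dg (e σ), Finsupp.linearCombination _ fun σ => (e σ).1,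
    inferInstance, ?_, ?_, ?_⟩
  · intro σ τ m hm
    rw [hsingle, ← hdg _ (htH (e σ).2), homogenize_apply] at hm
    split_ifs at hm with h
    · rw [Finset.mem_singleton.1 (support_monomial_subset hm), tsub_add_cancel_of_le h]
    · simp at hm
  · rw [Finsupp.range_linearCombination, ← htK]
    congr 1
    ext y
    constructor
    · rintro ⟨σ, rfl⟩
      exact (e σ).2
    · intro hy
      exact ⟨e.symm ⟨y, hy⟩, by simp⟩
  · intro x hx τ hτ
    -- A unit coefficient in a relation makes the generator `e τ` redundant, against minimality of
    -- the cardinality.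
    have hmem : (e τ : ι →₀ MvPolynomial (Fin n) k) ∈
        Submodule.span (MvPolynomial (Fin n) k) (t.erase (e τ) : Set _) := by
      rw [← Submodule.smul_mem_iff_of_isUnit _ hτ]
      have hsplit := Finsupp.single_add_erase τ x
      rw [← hsplit, map_add, Finsupp.linearCombination_single] at hx
      rw [eq_neg_of_add_eq_zero_left hx]
      refine Submodule.neg_mem _ ?_
      rw [Finsupp.linearCombination_apply, Finsupp.sum]
      refine Submodule.sum_mem _ fun σ hσ => Submodule.smul_mem _ _ (Submodule.subset_span ?_)
      rw [Finsupp.support_erase, Finset.mem_erase] at hσ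
      rw [Finset.mem_coe, Finset.mem_erase]
      exact ⟨fun h => hσ.1 (e.injective (Subtype.ext h)), (e σ).2⟩
    have hle := hmin (j := t.erase (e τ))
      ⟨fun y hy => htH (Finset.mem_of_mem_erase hy), le_antisymm ?_ ?_⟩
      (Finset.card_le_card (Finset.erase_subset _ _))
    · exact absurd hle (not_le.2 (Finset.card_erase_lt_of_mem (e τ).2))
    · rw [← htK]
      exact Submodule.span_mono (Finset.coe_subset.2 (Finset.erase_subset _ _))
    · rw [← htK, Submodule.span_le]
      intro y hy
      by_cases hye : y = e τ
      · exact hye ▸ hmem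
      · exact Submodule.subset_span (Finset.mem_coe.2 (Finset.mem_erase.2 ⟨hye, hy⟩))

theorem exists_minimal_augmentation (M : Ideal (MvPolynomial (Fin n) k)) :
    ∃ (ι : Type v) (deg : ι → Fin n →₀ ℕ) (c : ι → k)
      (g : (ι →₀ MvPolynomial (Fin n) k) →ₗ[MvPolynomial (Fin n) k]
        (MvPolynomial (Fin n) k ⧸ M)),
      Finite ι ∧ (∀ σ, g (Finsupp.single σ 1) = Ideal.Quotient.mk M (monomial (deg σ) (c σ))) ∧
        Function.Surjective g ∧ ∀ x, g x = 0 → ∀ τ, ¬ IsUnit (x τ) := by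
  -- For `M = ⊤` a cover by `S` would have the unit 1 in its kernel, so the zero module is taken.
  by_cases hM : M = ⊤
  · have : Subsingleton (MvPolynomial (Fin n) k ⧸ M) := Ideal.Quotient.subsingleton_iff.2 hM
    exact ⟨PEmpty, nofun, nofun, 0, inferInstance, nofun, fun y => ⟨0, Subsingleton.elim _ _⟩,
      fun _ _ => nofun⟩
  · refine ⟨PUnit, fun _ => 0, fun _ => 1, M.mkQ ∘ₗ Finsupp.lapply PUnit.unit, inferInstance,
      fun σ => by simp, fun y => ?_, fun x hx τ hτ => hM ?_⟩
    · obtain ⟨p, rfl⟩ := Submodule.mkQ_surjective M y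
      exact ⟨Finsupp.single PUnit.unit p, by simp⟩
    · refine M.eq_top_of_isUnit_mem ?_ hτ
      exact Ideal.Quotient.eq_zero_iff_mem.1 hx

variable (n k) in
/-- A homogeneous map between free modules of finite rank whose kernel has no coordinates that are
units. -/
structure ResolutionStage where
  /-- The basis of the target. -/
  target : Type v
  /-- The basis of the source. -/
  source : Type v
  finite : Finite source
  /-- The multidegrees of the basis elements of the target. -/
  degTarget : target → Fin n →₀ ℕ
  /-- The multidegrees of the basis elements of the source. -/
  degSource : source → Fin n →₀ ℕ
  /-- The map. -/
  map : (source →₀ MvPolynomial (Fin n) k) →ₗ[MvPolynomial (Fin n) k]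
    (target →₀ MvPolynomial (Fin n) k)
  isHomogeneousMap : IsHomogeneousMap degTarget degSource map
  not_isUnit : ∀ x, map x = 0 → ∀ τ, ¬ IsUnit (x τ)

namespace ResolutionStage

theorem exists_cover (s : ResolutionStage.{u, v} n k) :
    ∃ (κ : Type v) (degκ : κ → Fin n →₀ ℕ)
      (f : (κ →₀ MvPolynomial (Fin n) k) →ₗ[MvPolynomial (Fin n) k]
        (s.source →₀ MvPolynomial (Fin n) k)),
      Finite κ ∧ IsHomogeneousMap s.degSource degκ f ∧ LinearMap.range f = LinearMap.ker s.map ∧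
        ∀ x, f x = 0 → ∀ τ, ¬ IsUnit (x τ) :=
  have := s.finite
  exists_minimal_cover s.degSource (LinearMap.ker s.map)
    fun _ hx l => homogenize_degPart_mem_ker s.isHomogeneousMap hx l

/-- A minimal cover of the kernel. -/
def next (s : ResolutionStage.{u, v} n k) : ResolutionStage.{u, v} n k where
  target := s.source
  source := s.exists_cover.choose
  finite := s.exists_cover.choose_spec.choose_spec.choose_spec.1
  degTarget := s.degSource
  degSource := s.exists_cover.choose_spec.choose
  map := s.exists_cover.choose_spec.choose_spec.choose
  isHomogeneousMap := s.exists_cover.choose_spec.choose_spec.choose_spec.2.1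
  not_isUnit := s.exists_cover.choose_spec.choose_spec.choose_spec.2.2.2

theorem range_next (s : ResolutionStage.{u, v} n k) :
    LinearMap.range s.next.map = LinearMap.ker s.map :=
  s.exists_cover.choose_spec.choose_spec.choose_spec.2.2.1

/-- The `i`-th iterate of `next`. -/
def iterate (s : ResolutionStage.{u, v} n k) : ℕ → ResolutionStage.{u, v} n k
  | 0 => s
  | i + 1 => (s.iterate i).next

end ResolutionStage

/-- The quotient by a monomial ideal has a minimal multigraded free resolution. -/
theorem exists_isMinimal {M : Ideal (MvPolynomial (Fin n) k)} (hM : IsMonomialIdeal M) :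
    ∃ F : MultigradedFreeResolution.{u, v} M, F.IsMinimal := by
  obtain ⟨ι, deg, c, g, hι, hg, hsurj, hunit⟩ := exists_minimal_augmentation.{u, v} M
  obtain ⟨κ, degκ, f, hκ, hf, hrange, hunit'⟩ := exists_minimal_cover deg (LinearMap.ker g)
    fun x hx l => homogenize_degPart_mem_ker_augmentation hM hg hx l
  let s : ResolutionStage.{u, v} n k := ⟨ι, κ, hκ, deg, degκ, f, hf, hunit'⟩
  have hexact : ∀ i, Function.Exact (s.iterate (i + 1)).map (s.iterate i).map := fun i =>
    LinearMap.exact_iff.2 (s.iterate i).range_next.symm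
  have hzero : Function.Exact f g := LinearMap.exact_iff.2 hrange.symm
  refine ⟨{
    basis := fun i => (s.iterate i).target
    mdeg := fun {i} => (s.iterate i).degTarget
    d := fun i => (s.iterate i).map
    aug := g
    d_homogeneous := fun i => (s.iterate i).isHomogeneousMap
    aug_homogeneous := fun σ => ⟨c σ, hg σ⟩
    aug_surjective := hsurj
    exact_zero := hzero
    exact_succ := hexact }, ?_⟩
  intro i σ τ
  match i with
  | 0 => exact hunit _ (hzero.apply_apply_eq_zero _) τ
  | i + 1 => exact (s.iterate i).not_isUnit _ ((hexact i).apply_apply_eq_zero _) τ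

/-! ### Dominant sets and socle degrees -/

variable {M : Ideal (MvPolynomial (Fin n) k)}

theorem monomial_mem_iff (hM : IsMonomialIdeal M) {b : Fin n →₀ ℕ} :
    monomial b (1 : k) ∈ M ↔ ∃ a ∈ minimalGenerators M, a ≤ b := by
  conv_lhs => rw [← (isLeast_minimalGenerators hM).1]
  exact mem_monomialSpan_iff

theorem quotientSupport_iff (hM : IsMonomialIdeal M) {l : Fin n → ℤ} :
    QuotientSupport M l ↔ 0 ≤ l ∧ ∀ a ∈ minimalGenerators M, ¬ castDegree a ≤ l := by
  constructor
  · rintro ⟨m, rfl, hm⟩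
    rw [monomial_mem_iff hM] at hm
    exact ⟨fun i => Int.natCast_nonneg _, fun a ha h => hm ⟨a, ha, castDegree_le.1 h⟩⟩
  · rintro ⟨h0, h⟩
    obtain ⟨m, rfl⟩ := exists_castDegree h0
    rw [quotientSupport_castDegree, monomial_mem_iff hM]
    rintro ⟨a, ha, ham⟩
    exact h a ha (castDegree_le.2 ham)

/-- Positivity of `l` covers the variables absent from `a`, about which strong divisibility says
nothing. -/
theorem stronglyDivides_iff {a l : Fin n →₀ ℕ} (hl : ∀ i, 0 < l i) :
    StronglyDivides a l ↔ castDegree a ≤ castDegree l - 1 := by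
  refine forall_congr' fun i => ?_
  have := hl i
  simp only [castDegree, Pi.sub_apply, Pi.one_apply]
  omega

theorem le_sub_one_add_single_iff {a l : Fin n →₀ ℕ} (i : Fin n) :
    castDegree a ≤ castDegree l - 1 + Pi.single i 1 ↔ a i ≤ l i ∧ ∀ j, j ≠ i → a j < l j := by
  constructor
  · intro h
    refine ⟨?_, fun j hj => ?_⟩
    · have := h i
      simp [castDegree] at this
      omega
    · have := h j
      simp [castDegree, hj] at this
      omega
  · rintro ⟨h1, h2⟩ j
    by_cases hj : j = i
    · subst hj
      simp [castDegree]
      omega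
    · have := h2 j hj
      simp [castDegree, hj]
      omega

theorem monomialLcm_apply_eq {D : Finset (Fin n →₀ ℕ)} {m : Fin n →₀ ℕ} (hm : m ∈ D) {i : Fin n}
    (h : ∀ m' ∈ D, m' i ≤ m i) : monomialLcm D i = m i := by
  refine le_antisymm ?_ (Finset.le_sup (f := id) hm i)
  -- Lowering the entry at `i` to `m i` still leaves an upper bound of `D`.
  have : monomialLcm D ≤ Finsupp.update (monomialLcm D) i (m i) := by
    refine Finset.sup_le fun m' hm' j => ?_
    by_cases hj : j = i
    · subst hj
      simpa using h m' hm'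
    · have hle : m' ≤ monomialLcm D := Finset.le_sup (f := id) hm'
      simpa [hj] using hle j
  simpa using this i

/-- The degrees of the lcms of the dominant sets in `dominantClass M` are the multidegrees of the
socle of the quotient by `M`, shifted by `(1, …, 1)`. -/
theorem exists_mem_dominantClass_iff (hM : IsMonomialIdeal M) (l : Fin n →₀ ℕ) :
    (∃ D ∈ dominantClass M, l = monomialLcm D) ↔
      QuotientSupport M (castDegree l - 1) ∧
        ∀ a, ¬ QuotientSupport M (castDegree l - 1 + Pi.single a 1) := by
  classical
  constructor
  · rintro ⟨D, ⟨hDG, hD, hcard, hstrong⟩, rfl⟩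
    choose x hx using fun m : D => hD m m.2
    have hinj : Function.Injective x := by
      intro a b hab
      by_contra hne
      have h1 := hx a b b.2 fun h => hne (Subtype.ext h.symm)
      have h2 := hx b a a.2 fun h => hne (Subtype.ext h)
      rw [hab] at h1
      omega
    -- Distinct elements dominate in distinct variables, and there are as many elements as
    -- variables.
    have hsurj : Function.Surjective x :=
      ((Fintype.bijective_iff_injective_and_card x).2 ⟨hinj, by simp [hcard]⟩).2
    choose m' hmx using hsurj
    let m : Fin n → Fin n →₀ ℕ := fun i => m' i
    have hmD : ∀ i, m i ∈ D := fun i => (m' i).2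
    have hlt : ∀ i, ∀ b ∈ D, b ≠ m i → b i < m i i := fun i b hb hne => by
      have := hx (m' i) b hb hne
      rwa [hmx] at this
    have hlcm : ∀ i, monomialLcm D i = m i i := fun i => by
      refine monomialLcm_apply_eq (hmD i) fun m' hm' => ?_
      by_cases h : m' = m i
      · rw [h]
      · exact (hlt i m' hm' h).le
    have hne : ∀ i j, i ≠ j → m i ≠ m j := fun i j hij h => hij (by
      rw [← hmx i, Subtype.ext h, hmx])
    -- If the lcm did not involve `x_i`, neither would `m i`, which is strictly smaller than the lcm
    -- at all other variables and would strongly divide it.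
    have hpos : ∀ i, 0 < monomialLcm D i := by
      intro i
      by_contra h0
      refine hstrong (m i) (hDG (hmD i)) fun j hj => ?_
      rw [hlcm]
      have hij : j ≠ i := by
        rintro rfl
        rw [hlcm] at h0
        omega
      exact hlt j _ (hmD i) (hne _ _ hij.symm)
    refine ⟨(quotientSupport_iff hM).2 ⟨fun i => ?_, fun a ha h => ?_⟩, fun i h => ?_⟩
    · have := hpos i
      simp [castDegree]
      omega
    · exact hstrong a ha ((stronglyDivides_iff hpos).2 h)
    · refine ((quotientSupport_iff hM).1 h).2 (m i) (hDG (hmD i)) ?_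
      rw [le_sub_one_add_single_iff]
      refine ⟨(hlcm i).ge, fun j hj => ?_⟩
      rw [hlcm]
      exact hlt j _ (hmD i) (hne _ _ hj.symm)
  · rintro ⟨h1, h2⟩
    obtain ⟨h0, h1⟩ := (quotientSupport_iff hM).1 h1
    have hpos : ∀ i, 0 < l i := fun i => by
      have := h0 i
      simp [castDegree] at this
      omega
    have hex : ∀ i, ∃ a ∈ minimalGenerators M, a i = l i ∧ ∀ j, j ≠ i → a j < l j := by
      intro i
      have := h2 i
      rw [quotientSupport_iff hM] at this
      push Not at this
      obtain ⟨a, ha, hal⟩ := this (add_nonneg h0 (Pi.single_nonneg.2 zero_le_one))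
      obtain ⟨hai, haj⟩ := (le_sub_one_add_single_iff i).1 hal
      refine ⟨a, ha, le_antisymm hai ?_, haj⟩
      -- A smaller exponent at `i` would make `a` divide the monomial with exponents `l - 1`, which
      -- is outside `M`.
      by_contra! hlt
      refine h1 a ha ((stronglyDivides_iff hpos).1 fun j _ => ?_)
      by_cases hj : j = i
      · exact hj ▸ hlt
      · exact haj j hj
    choose m hmG hmi hmj using hex
    have hinj : Function.Injective m := by
      intro i j hij
      by_contra hne
      have := hmj j i hne
      rw [← hij, hmi] at this
      exact lt_irrefl _ this
    have hlcm : l = monomialLcm (Finset.univ.image m) := by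
      ext i
      rw [monomialLcm_apply_eq (Finset.mem_image_of_mem m (Finset.mem_univ i)), hmi]
      intro m' hm'
      obtain ⟨j, -, rfl⟩ := Finset.mem_image.1 hm'
      by_cases hj : i = j
      · rw [hj]
      · rw [hmi]
        exact (hmj j i hj).le
    refine ⟨Finset.univ.image m, ⟨?_, ?_, ?_, fun g hg hgl => ?_⟩, hlcm⟩
    · intro a ha
      obtain ⟨i, -, rfl⟩ := Finset.mem_image.1 (Finset.mem_coe.1 ha)
      exact hmG i
    · intro a ha
      obtain ⟨i, -, rfl⟩ := Finset.mem_image.1 (Finset.mem_coe.1 ha)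
      refine ⟨i, fun b hb hne => ?_⟩
      obtain ⟨j, -, rfl⟩ := Finset.mem_image.1 (Finset.mem_coe.1 hb)
      rw [hmi]
      exact hmj j i fun h => hne (h ▸ rfl)
    · rw [Finset.card_image_of_injective _ hinj, Finset.card_univ, Fintype.card_fin]
    · rw [← hlcm] at hgl
      exact h1 g hg ((stronglyDivides_iff hpos).1 hgl)

end

end MonomialResolution

theorem mainTheorem2 {n : ℕ} {k : Type u} [Field k]
    (M : Ideal (MvPolynomial (Fin n) k)) (hM : MonomialResolution.IsMonomialIdeal M)
    (l : Fin n →₀ ℕ) :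
    ((∃ D ∈ MonomialResolution.dominantClass M, l = MonomialResolution.monomialLcm D) →
      MonomialResolution.MultigradedBettiEq.{u, v} M n l 1) ∧
    ((¬ ∃ D ∈ MonomialResolution.dominantClass M, l = MonomialResolution.monomialLcm D) →
      MonomialResolution.MultigradedBettiEq.{u, v} M n l 0) := by
  rw [MonomialResolution.exists_mem_dominantClass_iff hM]
  refine ⟨fun h => ⟨MonomialResolution.exists_isMinimal hM, fun F hF => ?_⟩,
    fun h => ⟨MonomialResolution.exists_isMinimal hM, fun F hF => ?_⟩⟩
  · rw [F.betti_eq hM hF, if_pos h]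
  · rw [F.betti_eq hM hF, if_neg h]
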